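/- Let $L$ and $s$ be positive integers, let $V$ be a nonempty subset of $\{s+1,\ldots,L+s\}$, put $t=|V|$, and let $k_t$ be the smallest element of $V$. Let $I_{L,s,V}$ be the set of integer partitions whose smallest part is $s$, whose parts are all at most $L+s$, and in which no element of $V$ occurs as a part. Let $D_{L,s,V}$ be the set of nonempty partitions with all parts in $\{s+1,\ldots,L+s\}$ in which the frequency of each element of $V$ is a perfect $t$-th power $m^t$ with $m\ge 0$ an integer. Write $|\pi|$ for the sum of the parts of $\pi$, and set $$F(s)=(10s-2)(15s-3)+8s,\qquad \kappa(s)=(12s-1)\bigl((s+1)+(s+2)+\cdots+(F(s)-1)\bigr)+1 .$$ Suppose that $$k_t\ \ge\ \left(2^{t+4}s+s^2\right)\frac{t^t}{t!}.$$ Then $\kappa(s)<(15s)^5$, and for all integers $N\ge\kappa(s)$, $$|\{\pi\in I_{L,s,V}:|\pi|=N\}|\ \ge\ |\{\pi\in D_{L,s,V}:|\pi|=N\}| .$$ -/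

import Mathlib

namespace ImpermissibleParts

/-- Membership in `I_{L,s,V}`: the smallest part of `π` is `s`, all parts are at most `L + s`,
and no element of `V` is a part. -/
def MemI (L s : ℕ) (V : Finset ℕ) {N : ℕ} (π : N.Partition) : Prop :=
  s ∈ π.parts ∧ (∀ i ∈ π.parts, s ≤ i) ∧ (∀ i ∈ π.parts, i ≤ L + s) ∧ ∀ k ∈ V, k ∉ π.parts

/-- Membership in `D_{L,s,V}`: `π` is nonempty, all its parts lie in `{s+1, …, L+s}`, and the
frequency of every element of `V` is a perfect `t`-th power `m ^ t` (`m ≥ 0`), `t = |V|`. -/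
def MemD (L s : ℕ) (V : Finset ℕ) {N : ℕ} (π : N.Partition) : Prop :=
  π.parts ≠ 0 ∧ (∀ i ∈ π.parts, s + 1 ≤ i ∧ i ≤ L + s) ∧
    ∀ k ∈ V, ∃ m : ℕ, π.parts.count k = m ^ V.card

open scoped Classical in
/-- The partitions of `N` that lie in `I_{L,s,V}`. -/
noncomputable def partitionsI (L s : ℕ) (V : Finset ℕ) (N : ℕ) : Finset N.Partition :=
  Finset.univ.filter fun π => MemI L s V π

open scoped Classical in
/-- The partitions of `N` that lie in `D_{L,s,V}`. -/
noncomputable def partitionsD (L s : ℕ) (V : Finset ℕ) (N : ℕ) : Finset N.Partition :=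
  Finset.univ.filter fun π => MemD L s V π

/-- `F(s) = (10s - 2)(15s - 3) + 8s`; used only for `s ≥ 1`, where no subtraction truncates. -/
def F (s : ℕ) : ℕ := (10 * s - 2) * (15 * s - 3) + 8 * s

/-- `κ(s) = (12s - 1)((s+1) + (s+2) + ⋯ + (F(s) - 1)) + 1`; used only for `s ≥ 1`. -/
def kappa (s : ℕ) : ℕ := (12 * s - 1) * (∑ i ∈ Finset.Icc (s + 1) (F s - 1), i) + 1

end ImpermissibleParts

namespace ImpermissibleParts

/-! Each partition in D is sent to one in I: some weight is traded for j ≥ 1 parts s and parts in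
[s+1, 2s+1], which avoid V since k_t ≥ 2s+2. The number j encodes what was traded.

Split the partition into its V-part β and the rest α. If β ≠ 0, all of β goes, with j = 12 r(β) + 1
for an injective numbering r. The j copies of s must fit inside β, so r(β) may be at most |β|/(16s).
Such an r exists because few β have bounded sum: their frequencies are t-th powers, counted by power
means and stars and bars (`card_mul_le_of_count_eq_pow`), which is where the bound on k_t enters. If
β = 0, either 12s copies of a part i become 12i copies of s, or all multiplicities are below 12s, N
≥ κ(s) forces a part x ≥ F(s), and x is split. The three cases have j ≡ 1 mod 12, j ≡ 0 mod 12 and j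
≡ 2 mod 3, so j tells them apart. -/

/-! ### Ranking by weight, and counting vectors by power sums. -/

/-- A finite family with at most `X / c` members of weight at most `X`, for all `X`, can be
numbered injectively by positive integers such that the number is at most `1 / c` of the weight. -/
lemma exists_ranking {α : Type*} [DecidableEq α] (W : α → ℕ) (c : ℕ) (T : Finset α) :
    (∀ X, (T.filter fun a => W a ≤ X).card * c ≤ X) →
    ∃ r : α → ℕ, (∀ a ∈ T, 1 ≤ r a ∧ r a ≤ T.card ∧ c * r a ≤ W a) ∧ Set.InjOn r T := by
  induction T using Finset.induction_on_max_value W with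
  | empty => intro _; exact ⟨fun _ => 0, by simp, by simp⟩
  | insert a T haT hmax ih =>
    intro h
    obtain ⟨r, hr, hinj⟩ := ih fun X =>
      (Nat.mul_le_mul_right c (Finset.card_le_card
        (Finset.filter_subset_filter _ (Finset.subset_insert a T)))).trans (h X)
    have hne : ∀ x ∈ T, x ≠ a := fun x hx he => haT (he ▸ hx)
    have hcard := Finset.card_insert_of_notMem haT
    refine ⟨Function.update r a (T.card + 1), ?_, ?_⟩
    · intro x hx
      rcases Finset.mem_insert.1 hx with rfl | hx
      -- No weight exceeds `W x`, so the count at `X = W x` covers the whole family, and `x` can be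
      -- numbered last.
      · have := h (W x)
        rw [Finset.filter_true_of_mem, hcard] at this
        · simp only [Function.update_self]
          exact ⟨by omega, by omega, by rwa [mul_comm]⟩
        · intro y hy
          rcases Finset.mem_insert.1 hy with rfl | hy
          · exact le_rfl
          · exact hmax y hy
      · rw [Function.update_of_ne (hne x hx)]
        obtain ⟨h1, h2, h3⟩ := hr x hx
        exact ⟨h1, by omega, h3⟩
    · intro x hx y hy hxy
      rcases Finset.mem_insert.1 hx with rfl | hx' <;> rcases Finset.mem_insert.1 hy with rfl | hy'
      · rfl
      · rw [Function.update_self, Function.update_of_ne (hne y hy')] at hxy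
        have := (hr y hy').2.1
        omega
      · rw [Function.update_self, Function.update_of_ne (hne x hx')] at hxy
        have := (hr x hx').2.1
        omega
      · rw [Function.update_of_ne (hne x hx'), Function.update_of_ne (hne y hy')] at hxy
        exact hinj hx' hy' hxy

/-- Stars and bars: the number of vectors of naturals with coordinate sum at most `M`. -/
lemma card_le_choose_of_sum_le {ι : Type*} [Fintype ι] [DecidableEq ι] (M : ℕ)
    (S : Finset (ι → ℕ)) (hS : ∀ m ∈ S, ∑ i, m i ≤ M) :
    S.card ≤ (M + Fintype.card ι).choose (Fintype.card ι) := by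
  -- The extra coordinate `none` absorbs the slack, turning the inequality into an equality.
  let f : S → {P : Option ι → ℕ // ∑ i, P i = M} := fun m =>
    ⟨fun o => o.elim (M - ∑ i, m.1 i) m.1, by
      have := hS m.1 m.2
      rw [Fintype.sum_option]
      simp only [Option.elim]
      omega⟩
  have hf : Function.Injective f := by
    intro m m' h
    apply Subtype.ext
    funext i
    exact congrFun (congrArg Subtype.val h) (some i)
  have hg := ((Sym.equivNatSumOfFintype (Option ι) M).symm.injective.comp hf)
  have := Fintype.card_le_of_injective _ hg
  rw [Fintype.card_coe, Sym.card_sym_eq_choose, Fintype.card_option] at this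
  rwa [show Fintype.card ι + 1 + M - 1 = M + Fintype.card ι by omega, Nat.choose_symm_add] at this

/-- The number of vectors in `ℕ ^ t` whose `t`-th powers sum to at most `Y` is at most
`2 ^ t * (t ^ t / t!) * Y`. -/
lemma card_mul_factorial_le_of_sum_pow_le {ι : Type*} [Fintype ι] [DecidableEq ι] [Nonempty ι]
    (Y : ℕ) (hY : 1 ≤ Y) (S : Finset (ι → ℕ))
    (hS : ∀ m ∈ S, ∑ i, m i ^ Fintype.card ι ≤ Y) :
    S.card * (Fintype.card ι).factorial ≤
      2 ^ Fintype.card ι * Fintype.card ι ^ Fintype.card ι * Y := by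
  obtain ⟨n, ht⟩ := Nat.exists_eq_add_of_lt (Fintype.card_pos (α := ι))
  rw [zero_add] at ht
  set t := Fintype.card ι with ht'
  rcases S.eq_empty_or_nonempty with rfl | hne
  · simp
  obtain ⟨m₀, hm₀, hmax⟩ := S.exists_max_image (fun m => ∑ i, m i) hne
  set M := ∑ i, m₀ i
  -- Power mean inequality, applied to the vector of largest coordinate sum.
  have hM : M ^ t ≤ t ^ t * Y := by
    have h := pow_sum_le_card_mul_sum_pow (s := (Finset.univ : Finset ι)) (f := m₀)
      (fun _ _ => Nat.zero_le _) n
    rw [Finset.card_univ, ← ht', ← ht] at h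
    calc M ^ t ≤ t ^ n * ∑ i, m₀ i ^ t := h
      _ ≤ t ^ t * Y := Nat.mul_le_mul (Nat.pow_le_pow_right (by omega) (by omega)) (hS _ hm₀)
  have hpow : (M + t) ^ t ≤ 2 ^ t * (t ^ t * Y) := by
    have h1 : (max M t) ^ t ≤ t ^ t * Y := by
      rcases max_choice M t with h | h <;> rw [h]
      · exact hM
      · exact Nat.le_mul_of_pos_right _ hY
    calc (M + t) ^ t ≤ (2 * max M t) ^ t := Nat.pow_le_pow_left (by omega) _
      _ = 2 ^ t * (max M t) ^ t := mul_pow _ _ _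
      _ ≤ _ := Nat.mul_le_mul_left _ h1
  calc S.card * t.factorial ≤ (M + t).choose t * t.factorial :=
        Nat.mul_le_mul_right _ (card_le_choose_of_sum_le M S hmax)
    _ = (M + t).descFactorial t := by rw [Nat.descFactorial_eq_factorial_mul_choose, mul_comm]
    _ ≤ (M + t) ^ t := Nat.descFactorial_le_pow _ _
    _ ≤ _ := by rw [mul_assoc]; exact hpow

/-! ### Small replacement parts, and the sizes of F and κ. -/

/-- A partition of `n ≥ s + 1` into parts in `[s + 1, 2 * s + 1]`. -/
def rep (s n : ℕ) : Multiset ℕ :=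
  Multiset.replicate (n / (s + 1) - 1) (s + 1) + {s + 1 + n % (s + 1)}

lemma sum_rep {s n : ℕ} (h : s + 1 ≤ n) : (rep s n).sum = n := by
  have h1 : 1 ≤ n / (s + 1) := (Nat.one_le_div_iff (by omega)).2 h
  have h2 := Nat.div_add_mod n (s + 1)
  obtain ⟨q, hq⟩ := Nat.exists_eq_add_of_le h1
  simp only [rep, Multiset.sum_add, Multiset.sum_replicate, Multiset.sum_singleton, smul_eq_mul]
  rw [hq] at h2 ⊢
  rw [show 1 + q - 1 = q by omega]
  linarith

lemma mem_rep {s n i : ℕ} (h : i ∈ rep s n) : s + 1 ≤ i ∧ i ≤ 2 * s + 1 := by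
  have : n % (s + 1) < s + 1 := Nat.mod_lt n (Nat.succ_pos s)
  rcases Multiset.mem_add.1 h with h | h
  · have := Multiset.eq_of_mem_replicate h
    omega
  · have := Multiset.mem_singleton.1 h
    omega

lemma F_le {s : ℕ} (hs : 1 ≤ s) : F s ≤ 150 * s ^ 2 := by
  obtain ⟨a, rfl⟩ := Nat.exists_eq_add_of_le hs
  rw [F, show 10 * (1 + a) - 2 = 10 * a + 8 by omega,
    show 15 * (1 + a) - 3 = 15 * a + 12 by omega]
  nlinarith

lemma le_F {s : ℕ} (hs : 1 ≤ s) : 48 * s ^ 2 + 25 * s + 1 ≤ F s := by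
  obtain ⟨a, rfl⟩ := Nat.exists_eq_add_of_le hs
  rw [F, show 10 * (1 + a) - 2 = 10 * a + 8 by omega,
    show 15 * (1 + a) - 3 = 15 * a + 12 by omega]
  nlinarith

lemma kappa_lt {s : ℕ} (hs : 1 ≤ s) : kappa s < (15 * s) ^ 5 := by
  have hF := F_le hs
  have h1 : (∑ i ∈ Finset.Icc (s + 1) (F s - 1), i) * 2 ≤ (150 * s ^ 2) * (150 * s ^ 2) := by
    calc (∑ i ∈ Finset.Icc (s + 1) (F s - 1), i) * 2 ≤ (∑ i ∈ Finset.range (F s), i) * 2 := by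
          refine Nat.mul_le_mul_right _ (Finset.sum_le_sum_of_subset fun i hi => ?_)
          rw [Finset.mem_Icc] at hi
          rw [Finset.mem_range]
          omega
      _ = F s * (F s - 1) := Finset.sum_range_id_mul_two _
      _ ≤ _ := Nat.mul_le_mul hF ((Nat.sub_le _ _).trans hF)
  have h2 : (12 * s - 1) * ((∑ i ∈ Finset.Icc (s + 1) (F s - 1), i) * 2) ≤
      (12 * s) * ((150 * s ^ 2) * (150 * s ^ 2)) := Nat.mul_le_mul (Nat.sub_le _ _) h1
  have h3 : 1 ≤ s ^ 5 := Nat.one_le_pow _ _ hs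
  rw [kappa]
  nlinarith

/-- κ(s) exceeds by one the largest sum attainable with parts in [s+1, F(s)-1], each used at most
12s-1 times. -/
lemma exists_le_of_kappa_le {s : ℕ} (hs : 1 ≤ s) {α : Multiset ℕ} (hα : ∀ i ∈ α, s + 1 ≤ i)
    (hsum : kappa s ≤ α.sum) (hc : ∀ i, α.count i < 12 * s) : ∃ x ∈ α, F s ≤ x := by
  by_contra! h
  have h1 : α.sum ≤ (12 * s - 1) * ∑ i ∈ Finset.Icc (s + 1) (F s - 1), i := by
    rw [Finset.sum_multiset_count, Finset.mul_sum]
    calc ∑ i ∈ α.toFinset, α.count i • i ≤ ∑ i ∈ α.toFinset, (12 * s - 1) * i := by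
          refine Finset.sum_le_sum fun i _ => Nat.mul_le_mul_right _ ?_
          have := hc i
          omega
      _ ≤ _ := by
          refine Finset.sum_le_sum_of_subset fun i hi => ?_
          rw [Multiset.mem_toFinset] at hi
          have h2 := hα i hi
          have h3 := h i hi
          rw [Finset.mem_Icc]
          omega
  rw [kappa] at hsum
  omega

/-! ### Partitions with no part in V. -/

/-- If `α` and `β` are multisets with all multiplicities below `c`, then `α + c • γ` determines
both `α` and `γ`. -/
lemma eq_of_add_nsmul_eq {c : ℕ} {α β γ δ : Multiset ℕ} (hα : ∀ i, α.count i < c)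
    (hβ : ∀ i, β.count i < c) (h : α + c • γ = β + c • δ) : α = β ∧ γ = δ := by
  have key : ∀ i, α.count i = β.count i ∧ γ.count i = δ.count i := fun i => by
    have h1 := congrArg (Multiset.count i) h
    simp only [Multiset.count_add, Multiset.count_nsmul] at h1
    have h2 := congrArg (· % c) h1
    have h3 := congrArg (· / c) h1
    have hc : 0 < c := (Nat.zero_le _).trans_lt (hα i)
    simp only [Nat.add_mul_mod_self_left, Nat.add_mul_div_left _ _ hc, Nat.mod_eq_of_lt (hα i),
      Nat.mod_eq_of_lt (hβ i), Nat.div_eq_of_lt (hα i), Nat.div_eq_of_lt (hβ i)] at h2 h3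
    omega
  exact ⟨Multiset.ext.2 fun i => (key i).1, Multiset.ext.2 fun i => (key i).2⟩

/-- The ways in which a partition `α` into admissible parts above `s` is changed into a partition
with `j` parts `s` and further parts `α'`: either `12 * s` copies of a part are traded for parts
`s`, or a part `x ≥ F s` is split. -/
def Shift (s : ℕ) (α : Multiset ℕ) (j : ℕ) (α' : Multiset ℕ) : Prop :=
  (∃ i, j = 12 * i ∧ α = α' + Multiset.replicate (12 * s) i) ∨
  ((∀ i, α.count i < 12 * s) ∧ ∃ x ∈ α, F s ≤ x ∧ j = 3 * (x % (12 * s)) + 2 ∧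
    α' = α.erase x + rep s (s + 1 + (x - j * s - (s + 1)) % (12 * s)) +
      (12 * s) • rep s ((x - j * s - (s + 1)) / (12 * s)))

lemma Shift.mod_ne {s j : ℕ} {α α' : Multiset ℕ} (h : Shift s α j α') : j % 12 ≠ 1 := by
  rcases h with ⟨i, rfl, -⟩ | ⟨-, x, -, -, rfl, -⟩ <;> omega

/-- A part x ≥ F(s) can pay for its j copies of s and leave enough for both calls of `rep`, each of
which needs an argument of at least s+1. -/
lemma le_of_F_le {s x : ℕ} (hs : 1 ≤ s) (hx : F s ≤ x) :
    (3 * (x % (12 * s)) + 2) * s + (s + 1) + (12 * s) * (s + 1) ≤ x := by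
  have h1 : x % (12 * s) < 12 * s := Nat.mod_lt _ (by omega)
  have h2 := le_F hs
  have h3 : (3 * (x % (12 * s)) + 2) * s ≤ (36 * s) * s := Nat.mul_le_mul_right _ (by omega)
  nlinarith

/-- When a part x was split, j gives x mod 12s, hence the remainder block, which cancels.
Multiplicities mod 12s then separate the old parts from the quotient block, whose sum gives the
quotient and so x. -/
lemma Shift.injective {s j : ℕ} (hs : 1 ≤ s) {α β α' : Multiset ℕ} (hα : Shift s α j α')
    (hβ : Shift s β j α') : α = β := by
  rcases hα with ⟨i, hi, hα⟩ | ⟨hα, x, hx, hFx, hjx, hαx⟩ <;>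
  rcases hβ with ⟨i', hi', hβ⟩ | ⟨hβ, y, hy, hFy, hjy, hβy⟩
  · obtain rfl : i = i' := by omega
    rw [hα, hβ]
  · omega
  · omega
  · have hmod : x ≡ y [MOD 12 * s] := by
      have : x % (12 * s) = y % (12 * s) := by omega
      exact this
    have hx1 := le_of_F_le hs hFx
    have hy1 := le_of_F_le hs hFy
    rw [← hjx] at hx1
    rw [← hjy] at hy1
    obtain ⟨a, ha⟩ : ∃ a, x = a + (j * s + (s + 1)) := ⟨x - (j * s + (s + 1)), by omega⟩
    obtain ⟨b, hb⟩ : ∃ b, y = b + (j * s + (s + 1)) := ⟨y - (j * s + (s + 1)), by omega⟩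
    have hab : a % (12 * s) = b % (12 * s) := by
      rw [ha, hb] at hmod
      exact Nat.ModEq.add_right_cancel' _ hmod
    rw [show x - j * s - (s + 1) = a by omega] at hαx
    rw [show y - j * s - (s + 1) = b by omega, ← hab, hαx, add_right_comm,
      add_right_comm (β.erase y)] at hβy
    obtain ⟨h1, h2⟩ := eq_of_add_nsmul_eq
      (fun i => (Multiset.count_le_of_le i (Multiset.erase_le x α)).trans_lt (hα i))
      (fun i => (Multiset.count_le_of_le i (Multiset.erase_le y β)).trans_lt (hβ i))
      (add_right_cancel hβy)
    have h3 := congrArg Multiset.sum h2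
    have hdiv : ∀ z, (12 * s) * (s + 1) ≤ z → s + 1 ≤ z / (12 * s) := fun z hz =>
      (Nat.le_div_iff_mul_le (by omega)).2 (by rwa [mul_comm])
    rw [sum_rep (hdiv a (by omega)), sum_rep (hdiv b (by omega))] at h3
    have hxy : a = b := by rw [← Nat.div_add_mod a (12 * s), h3, hab, Nat.div_add_mod]
    obtain rfl : x = y := by omega
    rw [← Multiset.cons_erase hx, h1, Multiset.cons_erase hy]

lemma Shift.exists {s : ℕ} (hs : 1 ≤ s) {α : Multiset ℕ} (hα : ∀ i ∈ α, s + 1 ≤ i)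
    (hsum : kappa s ≤ α.sum) :
    ∃ j α', Shift s α j α' ∧ 1 ≤ j ∧ j * s + α'.sum = α.sum ∧
      ∀ i ∈ α', i ∈ α ∨ (s + 1 ≤ i ∧ i ≤ 2 * s + 1) := by
  by_cases hc : ∀ i, α.count i < 12 * s
  · obtain ⟨x, hx, hF⟩ := exists_le_of_kappa_le hs hα hsum hc
    refine ⟨_, _, Or.inr ⟨hc, x, hx, hF, rfl, rfl⟩, by omega, ?_, ?_⟩
    · have h1 := le_of_F_le hs hF
      set J := (3 * (x % (12 * s)) + 2) * s
      have h2 : s + 1 ≤ (x - J - (s + 1)) / (12 * s) :=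
        (Nat.le_div_iff_mul_le (by omega)).2 (by rw [mul_comm]; omega)
      have h3 := Nat.div_add_mod (x - J - (s + 1)) (12 * s)
      rw [Multiset.sum_add, Multiset.sum_add, Multiset.sum_nsmul, sum_rep h2, sum_rep (by omega),
        smul_eq_mul]
      have h4 := Multiset.sum_erase hx
      omega
    · intro i hi
      rcases Multiset.mem_add.1 hi with hi | hi
      · rcases Multiset.mem_add.1 hi with hi | hi
        · exact Or.inl (Multiset.mem_of_mem_erase hi)
        · exact Or.inr (mem_rep hi)
      · exact Or.inr (mem_rep (Multiset.mem_of_mem_nsmul hi))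
  · push Not at hc
    obtain ⟨i, hi⟩ := hc
    have hle := Multiset.le_count_iff_replicate_le.1 hi
    have hmem : i ∈ α := Multiset.count_pos.1 (by omega)
    have hi1 := hα i hmem
    have heq := Multiset.sub_add_cancel hle
    refine ⟨12 * i, α - Multiset.replicate (12 * s) i, Or.inl ⟨i, rfl, heq.symm⟩,
      by omega, ?_, fun k hk => Or.inl (Multiset.mem_of_le (Multiset.sub_le_self _ _) hk)⟩
    have h2 := congrArg Multiset.sum heq
    rw [Multiset.sum_add, Multiset.sum_replicate, smul_eq_mul] at h2
    rw [← h2]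
    ring

/-! ### Partitions with parts in V, and the combined injection. -/

/-- The parts of `π ∈ D` that lie in `V` have few possible values of bounded sum. -/
lemma card_mul_le_of_count_eq_pow {s : ℕ} (V : Finset ℕ) (hne : V.Nonempty)
    (hk : 2 ^ (V.card + 4) * s * V.card ^ V.card ≤ V.min' hne * V.card.factorial)
    (X : ℕ) (T : Finset (Multiset ℕ)) (hT : ∀ β ∈ T, β ≠ 0 ∧ (∀ i ∈ β, i ∈ V) ∧ β.sum ≤ X ∧
      ∀ k ∈ V, ∃ m : ℕ, β.count k = m ^ V.card) :
    T.card * (16 * s) ≤ X := by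
  classical
  rcases T.eq_empty_or_nonempty with rfl | ⟨β₀, hβ₀⟩
  · simp
  set k := V.min' hne with hkdef
  have hsumV : ∀ β ∈ T, β.sum = ∑ v : V, β.count v.1 * v.1 := fun β hβ => by
    rw [Finset.sum_coe_sort V (fun v => β.count v * v), Finset.sum_multiset_count]
    refine Finset.sum_subset (fun i hi => (hT β hβ).2.1 i (Multiset.mem_toFinset.1 hi)) ?_
    intro i _ hi
    rw [Multiset.mem_toFinset] at hi
    simp [Multiset.count_eq_zero.2 hi]
  have hmin : ∀ v : V, k ≤ v.1 := fun v => Finset.min'_le _ _ v.2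
  choose! root hroot using fun β (hβ : β ∈ T) => (hT β hβ).2.2.2
  have : Nonempty V := hne.to_subtype
  have ht : Fintype.card V = V.card := Fintype.card_coe V
  let f : Multiset ℕ → V → ℕ := fun β v => root β v.1
  have hf : Set.InjOn f T := by
    intro β hβ γ hγ h
    refine Multiset.ext.2 fun i => ?_
    by_cases hi : i ∈ V
    · rw [hroot β hβ i hi, hroot γ hγ i hi]
      exact congrArg (· ^ V.card) (congrFun h ⟨i, hi⟩)
    · rw [Multiset.count_eq_zero.2 fun h' => hi ((hT β hβ).2.1 i h'),
        Multiset.count_eq_zero.2 fun h' => hi ((hT γ hγ).2.1 i h')]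
  have hpow : ∀ β ∈ T, k * ∑ v, f β v ^ Fintype.card V ≤ X := fun β hβ => by
    refine le_trans ?_ (hT β hβ).2.2.1
    rw [hsumV β hβ, Finset.mul_sum]
    refine Finset.sum_le_sum fun v _ => ?_
    rw [ht, ← hroot β hβ v.1 v.2, mul_comm]
    exact Nat.mul_le_mul_left _ (hmin v)
  have hk0 : 0 < k ∨ s = 0 := by
    by_contra! h
    rw [Nat.eq_zero_of_le_zero h.1, zero_mul] at hk
    have h2 : 0 < V.card := hne.card_pos
    have h3 : 0 < s := Nat.pos_of_ne_zero h.2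
    have : 0 < 2 ^ (V.card + 4) * s * V.card ^ V.card := by positivity
    omega
  rcases hk0 with hk0 | rfl
  swap
  · simp
  -- A nonzero β has a part in V, so its sum is at least k.
  have hY : 1 ≤ X / k := by
    rw [Nat.one_le_div_iff hk0]
    obtain ⟨h0, hV, hX, -⟩ := hT β₀ hβ₀
    obtain ⟨i, hi⟩ := Multiset.exists_mem_of_ne_zero h0
    exact (Finset.min'_le _ _ (hV i hi)).trans ((Multiset.le_sum_of_mem hi).trans hX)
  have hcard := card_mul_factorial_le_of_sum_pow_le (X / k) hY (T.image f) (by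
    intro m hm
    obtain ⟨β, hβ, rfl⟩ := Finset.mem_image.1 hm
    rw [Nat.le_div_iff_mul_le hk0, mul_comm]
    exact hpow β hβ)
  rw [Finset.card_image_of_injOn hf, ht] at hcard
  have hdiv : k * (X / k) ≤ X := Nat.mul_div_le X k
  refine Nat.le_of_mul_le_mul_right (c := V.card.factorial) ?_ (Nat.factorial_pos _)
  calc T.card * (16 * s) * V.card.factorial = T.card * V.card.factorial * (16 * s) := by ring
    _ ≤ 2 ^ V.card * V.card ^ V.card * (X / k) * (16 * s) := Nat.mul_le_mul_right _ hcard
    _ = 2 ^ (V.card + 4) * s * V.card ^ V.card * (X / k) := by ring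
    _ ≤ k * V.card.factorial * (X / k) := Nat.mul_le_mul_right _ hk
    _ = k * (X / k) * V.card.factorial := by ring
    _ ≤ X * V.card.factorial := Nat.mul_le_mul_right _ hdiv

/-- How a partition `p`, with `V`-free part `α` and `V`-part `β`, is changed into one with `j`
parts `s` and further parts `α'`. Here `r` numbers the possible nonzero `β`. -/
def Transfer (s : ℕ) (V : Finset ℕ) (r : Multiset ℕ → ℕ) (p : Multiset ℕ) (j : ℕ)
    (α' : Multiset ℕ) : Prop :=
  (p.filter (· ∈ V) = 0 ∧ Shift s (p.filter (· ∉ V)) j α') ∨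
  (p.filter (· ∈ V) ≠ 0 ∧ j = 12 * r (p.filter (· ∈ V)) + 1 ∧
    α' = p.filter (· ∉ V) + rep s ((p.filter (· ∈ V)).sum - j * s))

/-- If parts in V were traded, j gives r(β), hence β; the added small parts are then known and
cancel. -/
lemma Transfer.injective {s j : ℕ} (hs : 1 ≤ s) {V : Finset ℕ} {r : Multiset ℕ → ℕ}
    {p q α' : Multiset ℕ} (hr : p.filter (· ∈ V) ≠ 0 → q.filter (· ∈ V) ≠ 0 →
      r (p.filter (· ∈ V)) = r (q.filter (· ∈ V)) → p.filter (· ∈ V) = q.filter (· ∈ V))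
    (hp : Transfer s V r p j α') (hq : Transfer s V r q j α') : p = q := by
  rw [← Multiset.filter_add_not (· ∈ V) p, ← Multiset.filter_add_not (· ∈ V) q]
  rcases hp with ⟨hp0, hp⟩ | ⟨hp0, hp, hpα⟩ <;> rcases hq with ⟨hq0, hq⟩ | ⟨hq0, hq, hqα⟩
  · rw [hp0, hq0, hp.injective hs hq]
  · have := hp.mod_ne
    omega
  · have := hq.mod_ne
    omega
  · have h := hr hp0 hq0 (by omega)
    rw [hqα, h] at hpα
    rw [h, add_right_cancel hpα]

lemma Transfer.exists {s L : ℕ} (hs : 1 ≤ s) {V : Finset ℕ} (hV : ∀ v ∈ V, 2 * s + 2 ≤ v)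
    (hL : s + 1 ≤ L) {r : Multiset ℕ → ℕ}
    {p : Multiset ℕ} (hp : ∀ i ∈ p, s + 1 ≤ i ∧ i ≤ L + s) (hsum : kappa s ≤ p.sum)
    (hr : p.filter (· ∈ V) ≠ 0 → 1 ≤ r (p.filter (· ∈ V)) ∧
      16 * s * r (p.filter (· ∈ V)) ≤ (p.filter (· ∈ V)).sum) :
    ∃ j α', Transfer s V r p j α' ∧ 1 ≤ j ∧ j * s + α'.sum = p.sum ∧
      ∀ i ∈ α', s + 1 ≤ i ∧ i ≤ L + s ∧ i ∉ V := by
  have hadd := congrArg Multiset.sum (Multiset.filter_add_not (· ∈ V) p)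
  rw [Multiset.sum_add] at hadd
  have hα : ∀ i ∈ p.filter (· ∉ V), s + 1 ≤ i ∧ i ≤ L + s ∧ i ∉ V := fun i hi => by
    obtain ⟨h1, h2⟩ := Multiset.mem_filter.1 hi
    exact ⟨(hp i h1).1, (hp i h1).2, h2⟩
  have hsmall : ∀ i, s + 1 ≤ i ∧ i ≤ 2 * s + 1 → s + 1 ≤ i ∧ i ≤ L + s ∧ i ∉ V :=
    fun i hi => ⟨hi.1, by omega, fun h => by have := hV i h; omega⟩
  by_cases h0 : p.filter (· ∈ V) = 0
  · rw [h0, Multiset.sum_zero, zero_add] at hadd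
    obtain ⟨j, α', h1, h2, h3, h4⟩ := Shift.exists hs (fun i hi => (hα i hi).1) (hadd ▸ hsum)
    exact ⟨j, α', Or.inl ⟨h0, h1⟩, h2, h3.trans hadd, fun i hi => (h4 i hi).elim (hα i) (hsmall i)⟩
  · obtain ⟨h1, h2⟩ := hr h0
    refine ⟨_, _, Or.inr ⟨h0, rfl, rfl⟩, by omega, ?_, ?_⟩
    · set ρ := r (p.filter (· ∈ V))
      -- The rate 16s leaves 4sρ ≥ 2s + 1 beyond the 12sρ spent.
      have h3 : (12 * ρ + 1) * s + (s + 1) ≤ (p.filter (· ∈ V)).sum := by nlinarith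
      rw [Multiset.sum_add, sum_rep (by omega)]
      omega
    · intro i hi
      rcases Multiset.mem_add.1 hi with hi | hi
      · exact hα i hi
      · exact hsmall i (mem_rep hi)

lemma card_partitionsD_le {L s N : ℕ} (hs : 1 ≤ s) {V : Finset ℕ} (hL : s + 1 ≤ L)
    (hV : ∀ v ∈ V, 2 * s + 2 ≤ v) (hne : V.Nonempty)
    (hk : 2 ^ (V.card + 4) * s * V.card ^ V.card ≤ V.min' hne * V.card.factorial)
    (hN : kappa s ≤ N) : (partitionsD L s V N).card ≤ (partitionsI L s V N).card := by
  classical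
  have hmem : ∀ π ∈ partitionsD L s V N, MemD L s V π := fun π hπ =>
    (Finset.mem_filter.1 hπ).2
  set T := ((partitionsD L s V N).image fun π => π.parts.filter (· ∈ V)).erase 0 with hT
  have hmemT : ∀ π ∈ partitionsD L s V N, π.parts.filter (· ∈ V) ≠ 0 →
      π.parts.filter (· ∈ V) ∈ T := fun π hπ h =>
    Finset.mem_erase.2 ⟨h, Finset.mem_image_of_mem _ hπ⟩
  obtain ⟨r, hr, hinj⟩ := exists_ranking Multiset.sum (16 * s) T fun X => by
    refine card_mul_le_of_count_eq_pow V hne hk X _ fun β hβ => ?_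
    obtain ⟨hβT, hX⟩ := Finset.mem_filter.1 hβ
    obtain ⟨h0, hβ'⟩ := Finset.mem_erase.1 hβT
    obtain ⟨π, hπ, rfl⟩ := Finset.mem_image.1 hβ'
    refine ⟨h0, fun i hi => (Multiset.mem_filter.1 hi).2, hX, fun k hkV => ?_⟩
    rw [Multiset.count_filter_of_pos hkV]
    exact (hmem π hπ).2.2 k hkV
  refine Finset.card_le_card_of_forall_subsingleton
    (fun π σ => ∃ j α', Transfer s V r π.parts j α' ∧ (∀ i ∈ α', s + 1 ≤ i) ∧
      σ.parts = Multiset.replicate j s + α') ?_ ?_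
  · intro π hπ
    obtain ⟨j, α', h1, h2, h3, h4⟩ := Transfer.exists (r := r) hs hV hL (hmem π hπ).2.1
      (by rwa [π.parts_sum]) fun h => by
        obtain ⟨h1, -, h2⟩ := hr _ (hmemT π hπ h)
        exact ⟨h1, h2⟩
    have hmemσ : ∀ i ∈ Multiset.replicate j s + α',
        i = s ∨ (s + 1 ≤ i ∧ i ≤ L + s ∧ i ∉ V) := fun i hi =>
      (Multiset.mem_add.1 hi).imp Multiset.eq_of_mem_replicate (h4 i)
    refine ⟨⟨Multiset.replicate j s + α', fun {i} hi => ?_, ?_⟩,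
      Finset.mem_filter.2 ⟨Finset.mem_univ _, ?_, ?_, ?_, ?_⟩,
      j, α', h1, fun i hi => (h4 i hi).1, rfl⟩
    · rcases hmemσ i hi with h | h <;> omega
    · rw [Multiset.sum_add, Multiset.sum_replicate, smul_eq_mul, h3, π.parts_sum]
    · exact Multiset.mem_add.2 (Or.inl (Multiset.mem_replicate.2 ⟨by omega, rfl⟩))
    · intro i hi
      rcases hmemσ i hi with h | h <;> omega
    · intro i hi
      rcases hmemσ i hi with h | h <;> omega
    · intro k hkV hk'
      rcases hmemσ k hk' with h | h
      · have := hV k hkV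
        omega
      · exact h.2.2 hkV
  · rintro σ - π ⟨hπ, j, α', hjα, hα', hσ⟩ π' ⟨hπ', j', α'', hjα', hα'', hσ'⟩
    rw [hσ] at hσ'
    have hcount : ∀ γ : Multiset ℕ, (∀ i ∈ γ, s + 1 ≤ i) → γ.count s = 0 := fun γ hγ =>
      Multiset.count_eq_zero.2 fun h => by have := hγ s h; omega
    -- All parts of `α'` and `α''` exceed s, so the frequency of s in σ is exactly j.
    have hj := congrArg (Multiset.count s) hσ'
    simp only [Multiset.count_add, Multiset.count_replicate_self, hcount _ hα',
      hcount _ hα'', add_zero] at hj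
    subst hj
    obtain rfl := add_left_cancel hσ'
    exact Nat.Partition.ext (hjα.injective hs
      (fun h h' he => hinj (hmemT π hπ h) (hmemT π' hπ' h') he) hjα')

end ImpermissibleParts

theorem mainTheorem3 (L s : ℕ) (hs : 1 ≤ s) (V : Finset ℕ)
    (hV : V ⊆ Finset.Icc (s + 1) (L + s)) (hne : V.Nonempty)
    (hk : ((2 : ℝ) ^ (V.card + 4) * (s : ℝ) + (s : ℝ) ^ 2) *
        ((V.card : ℝ) ^ V.card / (V.card.factorial : ℝ)) ≤ ((V.min' hne : ℕ) : ℝ)) :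
    ImpermissibleParts.kappa s < (15 * s) ^ 5 ∧
      ∀ N : ℕ, ImpermissibleParts.kappa s ≤ N →
        (ImpermissibleParts.partitionsD L s V N).card ≤
          (ImpermissibleParts.partitionsI L s V N).card := by
  have hfact : (0 : ℝ) < V.card.factorial := by exact_mod_cast Nat.factorial_pos _
  have hk' : 2 ^ (V.card + 4) * s * V.card ^ V.card ≤ V.min' hne * V.card.factorial := by
    rw [← mul_div_assoc, div_le_iff₀ hfact] at hk
    have h : ((2 : ℝ) ^ (V.card + 4) * s) * (V.card : ℝ) ^ V.card ≤
        ((V.min' hne : ℕ) : ℝ) * V.card.factorial :=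
      le_trans (mul_le_mul_of_nonneg_right (by nlinarith [sq_nonneg (s : ℝ)]) (by positivity)) hk
    exact_mod_cast h
  have hmin : 2 * s + 2 ≤ V.min' hne := by
    have h1 : 2 ^ (V.card + 4) * s ≤ V.min' hne := by
      refine Nat.le_of_mul_le_mul_right (c := V.card.factorial) ?_ (Nat.factorial_pos _)
      exact (Nat.mul_le_mul_left _ (Nat.factorial_le_pow _)).trans hk'
    have h2 : 2 ^ 4 ≤ 2 ^ (V.card + 4) := Nat.pow_le_pow_right (by omega) (by omega)
    nlinarith
  have hL := (Finset.mem_Icc.1 (hV (V.min'_mem hne))).2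
  exact ⟨ImpermissibleParts.kappa_lt hs, fun N hN =>
    ImpermissibleParts.card_partitionsD_le hs (by omega)
      (fun v hv => hmin.trans (Finset.min'_le _ _ hv)) hne hk' hN⟩
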